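/- Let $\mathcal{E}$ be an elementary topos with chosen finite products, and let $(\Sigma,E)$ be a finitary single-sorted algebraic signature $\Sigma$ with a set $E$ of equations between $\Sigma$-terms. A $(\Sigma,E)$-algebra in $\mathcal{E}$ is an object $A$ with morphisms $\sigma : A^n \to A$ for each $n$-ary $\sigma \in \Sigma$ satisfying the equations. An internal partially ordered commutative monoid $(Q,\otimes,k,\le)$ in $\mathcal{E}$ is an internal commutative monoid $(Q,\otimes,k)$ with an internal partial order ${\le} \hookrightarrow Q \times Q$ for which $\otimes$ is monotone; a morphism of such is a monotone monoid morphism. A $Q$-span $(X,f,g,\chi)$ from $A$ to $B$ consists of morphisms $f : X \to A$, $g : X \to B$, $\chi : X \to Q$ of $\mathcal{E}$; two are isomorphic if an isomorphism of apices commutes with all three morphisms. For $(\Sigma,E)$-algebras $A, B$ a $Q$-span is algebraic if, in the internal language of $\mathcal{E}$, for every $n$-ary $\sigma \in \Sigma$, whenever $f(x_i) = a_i$ and $g(x_i) = b_i$ for $1 \le i \le n$, there exists $x$ with $f(x) = \sigma(a_1,\dots,a_n)$, $g(x) = \sigma(b_1,\dots,b_n)$ and $\chi(x_1) \otimes \dots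 \otimes \chi(x_n) \le \chi(x)$. Let $\mathbf{Span}_{(\Sigma,E)}(Q)$ be the following preordered symmetric monoidal category. Objects are $(\Sigma,E)$-algebras, and morphisms are isomorphism classes of algebraic $Q$-spans. The identity on $A$ is $(A,1,1,\chi_k)$, where $\chi_k : A \to 1 \xrightarrow{k} Q$. The composite of $(X,f,g,\chi) : A \to B$ and $(Y,f',g',\xi) : B \to C$ is $(X \times_B Y,\, f p_1,\, g' p_2,\, \otimes \circ (\chi \times \xi) \circ \langle p_1,p_2\rangle)$, with $p_1,p_2$ the pullback projections. The monoidal structure is the product of algebras on objects, the terminal algebra as unit, and $(X,f,g,\chi) \otimes (X',f',g',\chi') = (X \times X', f \times f', g \times g', \otimes \circ (\chi \times \chi'))$ on morphisms, and its coherence isomorphisms and symmetry are the graphs $(A,1,c,\chi_k)$ of those, $c$, of the finite products. The preorder on morphisms is $(X_1,f_1,g_1,\chi_1) \subseteq (X_2,f_2,g_2,\chi_2)$ iff there is a monomorphism $m : X_1 \to X_2$ with $f_1 = f_2 m$, $g_1 = g_2 m$ and $\chi_1(x) \le \chi_2(m(x))$ for all $x$ internally. **Theorem.** Every morphism $h :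 Q_1 \to Q_2$ of internal partially ordered commutative monoids in $\mathcal{E}$ induces, by postcomposition $[(X,f,g,\chi)] \mapsto [(X,f,g,h \circ \chi)]$, an identity-on-objects strict symmetric monoidal $\mathbf{Preord}$-functor $$h^* : \mathbf{Span}_{(\Sigma,E)}(Q_1) \to \mathbf{Span}_{(\Sigma,E)}(Q_2)$$ (that is, a functor which is monotone on hom-preorders and preserves the unit, the tensor product, the coherence isomorphisms and the symmetry on the nose). The assignment $h \mapsto h^*$ is functorial: $(1_Q)^* = \mathrm{Id}$ and $(g \circ h)^* = g^* \circ h^*$ for all $h : Q_1 \to Q_2$ and $g : Q_2 \to Q_3$. -/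

import Mathlib

open CategoryTheory MonoidalCategory CartesianMonoidalCategory Limits
open scoped MonObj

universe w v u

namespace AlgSpan

/-! ### Finitary signatures, terms, varieties and their algebras -/

/-- A finitary single-sorted algebraic signature. -/
structure Signature where
  Op : Type w
  arity : Op → ℕ

/-- Terms over a signature in `n` variables. -/
inductive Signature.Term (S : Signature.{w}) (n : ℕ) : Type w
  | var (i : Fin n) : Signature.Term S n
  | app (σ : S.Op) (ts : Fin (S.arity σ) → Signature.Term S n) : Signature.Term S n

/-- A presentation `(Σ, E)` of a variety: a signature together with a set of equations between
terms in finitely many variables. -/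
structure Variety where
  sig : Signature.{w}
  eqns : ∀ n : ℕ, Set (sig.Term n × sig.Term n)

section Algebras

variable {E : Type u} [Category.{v} E] [HasFiniteProducts E]

variable (E) in
/-- An interpretation of the operations of `S` in `E`: an object `A` with morphisms
`σ : A ^ n ⟶ A` for each `n`-ary operation symbol. -/
structure SigAlgebra (S : Signature.{w}) where
  carrier : E
  op : ∀ σ : S.Op, (∏ᶜ fun _ : Fin (S.arity σ) => carrier) ⟶ carrier

namespace SigAlgebra

variable {S : Signature.{w}}

/-- `σ(x₁, ..., xₙ)` for generalized elements `xᵢ : T ⟶ A`. -/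
noncomputable def apply (A : SigAlgebra E S) (σ : S.Op) {T : E}
    (x : Fin (S.arity σ) → (T ⟶ A.carrier)) : T ⟶ A.carrier :=
  Pi.lift x ≫ A.op σ

/-- The value of a term at generalized elements `xᵢ : T ⟶ A`. -/
noncomputable def eval (A : SigAlgebra E S) {n : ℕ} {T : E} (x : Fin n → (T ⟶ A.carrier)) :
    S.Term n → (T ⟶ A.carrier)
  | .var i => x i
  | .app σ ts => A.apply σ fun i => A.eval x (ts i)

lemma comp_apply (A : SigAlgebra E S) (σ : S.Op) {T T' : E} (f : T' ⟶ T)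
    (x : Fin (S.arity σ) → (T ⟶ A.carrier)) :
    f ≫ A.apply σ x = A.apply σ fun i => f ≫ x i := by
  unfold apply
  rw [← Category.assoc]
  congr 1
  ext
  simp

lemma comp_eval (A : SigAlgebra E S) {n : ℕ} {T T' : E} (f : T' ⟶ T)
    (x : Fin n → (T ⟶ A.carrier)) (t : S.Term n) :
    f ≫ A.eval x t = A.eval (fun i => f ≫ x i) t := by
  induction t with
  | var i => rfl
  | app σ ts ih => simp only [eval, comp_apply, ih]

/-- Homomorphisms: morphisms of `E` commuting with all operations. -/
def IsHom (A B : SigAlgebra E S) (f : A.carrier ⟶ B.carrier) : Prop :=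
  ∀ σ : S.Op, A.op σ ≫ f = Limits.Pi.map (fun _ => f) ≫ B.op σ

lemma IsHom.apply_comp {A B : SigAlgebra E S} {f : A.carrier ⟶ B.carrier} (hf : IsHom A B f)
    (σ : S.Op) {T : E} (x : Fin (S.arity σ) → (T ⟶ A.carrier)) :
    A.apply σ x ≫ f = B.apply σ fun i => x i ≫ f := by
  unfold apply
  rw [Category.assoc, hf σ, ← Category.assoc]
  congr 1
  ext
  simp

lemma isHom_of_apply {A B : SigAlgebra E S} {f : A.carrier ⟶ B.carrier}
    (hf : ∀ (σ : S.Op) (T : E) (x : Fin (S.arity σ) → (T ⟶ A.carrier)),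
      A.apply σ x ≫ f = B.apply σ fun i => x i ≫ f) : IsHom A B f := by
  intro σ
  have h := hf σ _ (fun i => Pi.π (fun _ => A.carrier) i)
  have e1 : Pi.lift (fun i => Pi.π (fun _ : Fin (S.arity σ) => A.carrier) i) = 𝟙 _ := by
    ext; simp
  have e2 : Pi.lift (fun i => Pi.π (fun _ : Fin (S.arity σ) => A.carrier) i ≫ f) =
      Limits.Pi.map (fun _ => f) := by
    ext; simp
  simpa only [apply, e1, e2, Category.id_comp] using h

lemma IsHom.eval_comp {A B : SigAlgebra E S} {f : A.carrier ⟶ B.carrier} (hf : IsHom A B f)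
    {n : ℕ} {T : E} (x : Fin n → (T ⟶ A.carrier)) (t : S.Term n) :
    A.eval x t ≫ f = B.eval (fun i => x i ≫ f) t := by
  induction t with
  | var i => rfl
  | app σ ts ih => simp only [eval, hf.apply_comp, ih]

end SigAlgebra

variable (E) in
/-- A `(Σ, E)`-algebra: the two morphisms `A ^ n ⟶ A` interpreting the sides of each equation
coincide. -/
structure Variety.Algebra (V : Variety.{w}) extends SigAlgebra E V.sig where
  sound : ∀ (n : ℕ), ∀ p ∈ V.eqns n,
    toSigAlgebra.eval (fun i => Pi.π (fun _ : Fin n => carrier) i) p.1 =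
      toSigAlgebra.eval (fun i => Pi.π (fun _ : Fin n => carrier) i) p.2

lemma Variety.Algebra.eval_eq {V : Variety.{w}} (A : V.Algebra E) {n : ℕ}
    {p : V.sig.Term n × V.sig.Term n} (hp : p ∈ V.eqns n) {T : E}
    (x : Fin n → (T ⟶ A.carrier)) : A.eval x p.1 = A.eval x p.2 := by
  have h := congrArg (Pi.lift x ≫ ·) (A.sound n p hp)
  simpa [SigAlgebra.comp_eval] using h

end Algebras

section Cartesian

variable {E : Type u} [Category.{v} E] [CartesianMonoidalCategory E] [HasFiniteLimits E]

/-- The product of two algebras, with componentwise operations. -/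
@[reducible]
noncomputable def SigAlgebra.prod {S : Signature.{w}} (A B : SigAlgebra E S) :
    SigAlgebra E S where
  carrier := A.carrier ⊗ B.carrier
  op σ := lift (Limits.Pi.map (fun _ => fst A.carrier B.carrier) ≫ A.op σ)
    (Limits.Pi.map (fun _ => snd A.carrier B.carrier) ≫ B.op σ)

lemma SigAlgebra.isHom_fst {S : Signature.{w}} (A B : SigAlgebra E S) :
    SigAlgebra.IsHom (A.prod B) A (fst A.carrier B.carrier) := fun _ => lift_fst _ _

lemma SigAlgebra.isHom_snd {S : Signature.{w}} (A B : SigAlgebra E S) :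
    SigAlgebra.IsHom (A.prod B) B (snd A.carrier B.carrier) := fun _ => lift_snd _ _

lemma SigAlgebra.apply_fst {S : Signature.{w}} (A B : SigAlgebra E S) (σ : S.Op) {T : E}
    (x : Fin (S.arity σ) → (T ⟶ A.carrier ⊗ B.carrier)) :
    (A.prod B).apply σ x ≫ fst A.carrier B.carrier = A.apply σ fun i => x i ≫ fst _ _ :=
  (SigAlgebra.isHom_fst A B).apply_comp σ x

lemma SigAlgebra.apply_snd {S : Signature.{w}} (A B : SigAlgebra E S) (σ : S.Op) {T : E}
    (x : Fin (S.arity σ) → (T ⟶ A.carrier ⊗ B.carrier)) :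
    (A.prod B).apply σ x ≫ snd A.carrier B.carrier = B.apply σ fun i => x i ≫ snd _ _ :=
  (SigAlgebra.isHom_snd A B).apply_comp σ x

namespace SigAlgebra

variable {S : Signature.{w}} {A B C : SigAlgebra E S}

lemma IsHom.id (A : SigAlgebra E S) : IsHom A A (𝟙 A.carrier) :=
  isHom_of_apply fun σ T x => by simp

lemma IsHom.comp {f : A.carrier ⟶ B.carrier} {g : B.carrier ⟶ C.carrier} (hf : IsHom A B f)
    (hg : IsHom B C g) : IsHom A C (f ≫ g) :=
  isHom_of_apply fun σ T x => by
    rw [← Category.assoc, hf.apply_comp, hg.apply_comp]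
    simp only [Category.assoc]

lemma IsHom.inv {e : A.carrier ≅ B.carrier} (he : IsHom A B e.hom) : IsHom B A e.inv :=
  isHom_of_apply fun σ T x => by
    rw [← cancel_mono e.hom, he.apply_comp]
    simp

/-- A morphism into a product of algebras is a homomorphism if its two components are. -/
lemma isHom_prod {f : C.carrier ⟶ A.carrier ⊗ B.carrier} (h₁ : IsHom C A (f ≫ fst _ _))
    (h₂ : IsHom C B (f ≫ snd _ _)) : IsHom C (A.prod B) f :=
  isHom_of_apply fun σ T x => by
    apply CartesianMonoidalCategory.hom_ext
    · refine Eq.trans ?_ (apply_fst A B σ _).symm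
      rw [Category.assoc, h₁.apply_comp]
      simp only [Category.assoc]
    · refine Eq.trans ?_ (apply_snd A B σ _).symm
      rw [Category.assoc, h₂.apply_comp]
      simp only [Category.assoc]

variable (A B C)

lemma isHom_associator :
    IsHom ((A.prod B).prod C) (A.prod (B.prod C)) (α_ A.carrier B.carrier C.carrier).hom := by
  refine isHom_prod (A := A) (B := B.prod C) ?_ (isHom_prod ?_ ?_)
  · rw [associator_hom_fst]
    exact (isHom_fst (A.prod B) C).comp (isHom_fst A B)
  · rw [Category.assoc, associator_hom_snd_fst]
    exact (isHom_fst (A.prod B) C).comp (isHom_snd A B)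
  · rw [Category.assoc, associator_hom_snd_snd]
    exact isHom_snd (A.prod B) C

lemma isHom_braiding [BraidedCategory E] :
    IsHom (A.prod B) (B.prod A) (β_ A.carrier B.carrier).hom := by
  refine isHom_prod ?_ ?_
  · rw [braiding_hom_fst]
    exact isHom_snd A B
  · rw [braiding_hom_snd]
    exact isHom_fst A B

end SigAlgebra

namespace Variety.Algebra

variable {V : Variety.{w}}

/-- The product of two `(Σ, E)`-algebras. -/
@[reducible]
noncomputable def prod (A B : V.Algebra E) : V.Algebra E where
  toSigAlgebra := A.toSigAlgebra.prod B.toSigAlgebra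
  sound n p hp := by
    apply CartesianMonoidalCategory.hom_ext
    · exact ((SigAlgebra.isHom_fst _ _).eval_comp _ _).trans ((A.eval_eq hp _).trans
        ((SigAlgebra.isHom_fst _ _).eval_comp _ _).symm)
    · exact ((SigAlgebra.isHom_snd _ _).eval_comp _ _).trans ((B.eval_eq hp _).trans
        ((SigAlgebra.isHom_snd _ _).eval_comp _ _).symm)

variable (V E) in
/-- The terminal algebra. -/
@[reducible]
noncomputable def terminal : V.Algebra E where
  carrier := 𝟙_ E
  op _ := toUnit _
  sound _ _ _ := toUnit_unique _ _

end Variety.Algebra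

end Cartesian

/-! ### Internal partially ordered commutative monoids -/

section POCM

variable (E : Type u) [Category.{v} E] [CartesianMonoidalCategory E] [BraidedCategory E]

/-- An internal partially ordered commutative monoid `(Q, ⊗, k, ≤)` in `E`: a commutative monoid
object together with a subobject `≤` of `Q × Q` which is (on generalized elements) a partial order,
and for which the multiplication is monotone. -/
structure POCM where
  carrier : E
  [mon : MonObj carrier]
  [comm : IsCommMonObj carrier]
  le : Subobject (carrier ⊗ carrier)
  le_refl : ∀ {T : E} (a : T ⟶ carrier), le.Factors (lift a a)
  le_trans : ∀ {T : E} (a b c : T ⟶ carrier),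
    le.Factors (lift a b) → le.Factors (lift b c) → le.Factors (lift a c)
  le_antisymm : ∀ {T : E} (a b : T ⟶ carrier),
    le.Factors (lift a b) → le.Factors (lift b a) → a = b
  mul_le_mul : ∀ {T : E} (a b c d : T ⟶ carrier),
    le.Factors (lift a b) → le.Factors (lift c d) →
      le.Factors (lift (lift a c ≫ μ[carrier]) (lift b d ≫ μ[carrier]))

attribute [instance] POCM.mon POCM.comm

variable {E}

/-- `a ≤ b` for generalized elements `a b : T ⟶ Q`. -/
def POCM.Le (Q : POCM E) {T : E} (a b : T ⟶ Q.carrier) : Prop :=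
  Q.le.Factors (lift a b)

/-- Morphisms of internal partially ordered commutative monoids: monotone monoid morphisms. -/
@[ext]
structure POCM.Hom (Q₁ Q₂ : POCM E) where
  hom : Q₁.carrier ⟶ Q₂.carrier
  isMonHom : IsMonHom hom
  monotone : ∀ {T : E} (a b : T ⟶ Q₁.carrier), Q₁.Le a b → Q₂.Le (a ≫ hom) (b ≫ hom)

instance : Category (POCM E) where
  Hom := POCM.Hom
  id Q := ⟨𝟙 _, inferInstance, fun a b h => by simpa using h⟩
  comp f g := ⟨f.hom ≫ g.hom,
    (have := f.isMonHom; have := g.isMonHom; inferInstance),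
    fun a b h => by
      rw [← Category.assoc, ← Category.assoc]
      exact g.monotone _ _ (f.monotone _ _ h)⟩

namespace POCM

variable (Q : POCM E)

lemma Le.refl {T : E} (a : T ⟶ Q.carrier) : Q.Le a a := Q.le_refl a

lemma Le.of_eq {T : E} {a b : T ⟶ Q.carrier} (h : a = b) : Q.Le a b := h ▸ Q.le_refl a

variable {Q}

lemma Le.trans {T : E} {a b c : T ⟶ Q.carrier} (h₁ : Q.Le a b) (h₂ : Q.Le b c) : Q.Le a c :=
  Q.le_trans a b c h₁ h₂

lemma Le.comp {T T' : E} {a b : T ⟶ Q.carrier} (h : Q.Le a b) (f : T' ⟶ T) :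
    Q.Le (f ≫ a) (f ≫ b) := by
  unfold Le at *
  rw [← comp_lift]
  exact Subobject.factors_of_factors_right f h

lemma Le.mul {T : E} {a b c d : T ⟶ Q.carrier} (h₁ : Q.Le a b) (h₂ : Q.Le c d) :
    Q.Le (a * c) (b * d) :=
  Q.mul_le_mul a b c d h₁ h₂

lemma comp_prod {T T' : E} (f : T' ⟶ T) {J : Type*} (s : Finset J) (x : J → (T ⟶ Q.carrier)) :
    f ≫ ∏ i ∈ s, x i = ∏ i ∈ s, f ≫ x i :=
  map_prod (⟨⟨fun g : T ⟶ Q.carrier => f ≫ g, MonObj.comp_one f⟩,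
    fun a b => MonObj.comp_mul f a b⟩ : (T ⟶ Q.carrier) →* (T' ⟶ Q.carrier)) x s

end POCM

end POCM

/-! ### `Q`-spans -/

section Spans

variable {E : Type u} [Category.{v} E] [CartesianMonoidalCategory E] [BraidedCategory E]

/-- A `Q`-span `(X, f, g, χ)` from `A` to `B`. -/
structure QSpan (Q : POCM E) (A B : E) where
  apex : E
  left : apex ⟶ A
  right : apex ⟶ B
  char : apex ⟶ Q.carrier

namespace QSpan

variable {Q : POCM E} {A B C D A' B' C' : E}

/-- Two `Q`-spans are isomorphic if there is an isomorphism of the apices commuting with the legs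
and with the characteristic morphisms. -/
def Iso (s t : QSpan Q A B) : Prop :=
  ∃ e : s.apex ≅ t.apex,
    s.left = e.hom ≫ t.left ∧ s.right = e.hom ≫ t.right ∧ s.char = e.hom ≫ t.char

/-- `s ⊆ t`: there is a monomorphism of apices `m` commuting with the legs such that
`χ₁(x) ≤ χ₂(m(x))`. -/
def Sub (s t : QSpan Q A B) : Prop :=
  ∃ m : s.apex ⟶ t.apex, Mono m ∧
    s.left = m ≫ t.left ∧ s.right = m ≫ t.right ∧ Q.Le s.char (m ≫ t.char)

variable (Q A) in
/-- The identity `Q`-span `(A, 1, 1, χ_k)`, with `χ_k` constant at the unit `k`. -/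
@[reducible]
def id : QSpan Q A A where
  apex := A
  left := 𝟙 A
  right := 𝟙 A
  char := toUnit A ≫ η[Q.carrier]

/-- The graph `(A, 1, f, χ_k)` of a morphism. -/
@[reducible]
def graph (Q : POCM E) (f : A ⟶ B) : QSpan Q A B where
  apex := A
  left := 𝟙 A
  right := f
  char := toUnit A ≫ η[Q.carrier]

/-- Composition by pullback (in diagrammatic order), multiplying the characteristic morphisms. -/
@[reducible]
noncomputable def comp [HasFiniteLimits E] (s : QSpan Q A B) (t : QSpan Q B C) : QSpan Q A C where
  apex := pullback s.right t.left
  left := pullback.fst _ _ ≫ s.left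
  right := pullback.snd _ _ ≫ t.right
  char := lift (pullback.fst s.right t.left) (pullback.snd s.right t.left) ≫
    (s.char ⊗ₘ t.char) ≫ μ[Q.carrier]

/-- The tensor product of `Q`-spans. -/
@[reducible]
def tensor (s : QSpan Q A B) (t : QSpan Q A' B') : QSpan Q (A ⊗ A') (B ⊗ B') where
  apex := s.apex ⊗ t.apex
  left := s.left ⊗ₘ t.left
  right := s.right ⊗ₘ t.right
  char := (s.char ⊗ₘ t.char) ≫ μ[Q.carrier]

/-- Postcomposition of the characteristic morphism with `h`. -/
@[reducible]
def postcomp {Q₁ Q₂ : POCM E} (s : QSpan Q₁ A B) (h : Q₁ ⟶ Q₂) : QSpan Q₂ A B where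
  apex := s.apex
  left := s.left
  right := s.right
  char := s.char ≫ h.hom

lemma Iso.mk' {X Y : E} {f : X ⟶ A} {g : X ⟶ B} {χ : X ⟶ Q.carrier} {f' : Y ⟶ A} {g' : Y ⟶ B}
    {χ' : Y ⟶ Q.carrier} (e : X ≅ Y) (h₁ : f = e.hom ≫ f') (h₂ : g = e.hom ≫ g')
    (h₃ : χ = e.hom ≫ χ') : Iso (Q := Q) ⟨X, f, g, χ⟩ ⟨Y, f', g', χ'⟩ := ⟨e, h₁, h₂, h₃⟩

lemma Sub.mk' {X Y : E} {f : X ⟶ A} {g : X ⟶ B} {χ : X ⟶ Q.carrier} {f' : Y ⟶ A} {g' : Y ⟶ B}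
    {χ' : Y ⟶ Q.carrier} (m : X ⟶ Y) (hm : Mono m) (h₁ : f = m ≫ f') (h₂ : g = m ≫ g')
    (h₃ : Q.Le χ (m ≫ χ')) : Sub (Q := Q) ⟨X, f, g, χ⟩ ⟨Y, f', g', χ'⟩ := ⟨m, hm, h₁, h₂, h₃⟩

lemma lift_mul {T X Y : E} (a : T ⟶ X) (b : T ⟶ Y) (χ : X ⟶ Q.carrier) (ξ : Y ⟶ Q.carrier) :
    lift a b ≫ (χ ⊗ₘ ξ) ≫ μ[Q.carrier] = (a ≫ χ) * (b ≫ ξ) := by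
  change _ = lift _ _ ≫ μ[Q.carrier]
  simp

lemma tensor_mul {X Y : E} (χ : X ⟶ Q.carrier) (ξ : Y ⟶ Q.carrier) :
    (χ ⊗ₘ ξ) ≫ μ[Q.carrier] = (fst X Y ≫ χ) * (snd X Y ≫ ξ) := by
  rw [← lift_mul]
  simp

lemma unit_char (X : E) : toUnit X ≫ η[Q.carrier] = 1 := rfl

lemma Iso.refl (s : QSpan Q A B) : s.Iso s := ⟨CategoryTheory.Iso.refl _, by simp⟩

lemma Iso.symm {s t : QSpan Q A B} : s.Iso t → t.Iso s := by
  rintro ⟨e, h₁, h₂, h₃⟩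
  exact ⟨e.symm, by simp [h₁], by simp [h₂], by simp [h₃]⟩

lemma Iso.trans {s t r : QSpan Q A B} : s.Iso t → t.Iso r → s.Iso r := by
  rintro ⟨e, h₁, h₂, h₃⟩ ⟨e', h₁', h₂', h₃'⟩
  exact ⟨e ≪≫ e', by simp [h₁, h₁'], by simp [h₂, h₂'], by simp [h₃, h₃']⟩

lemma Iso.sub {s t : QSpan Q A B} : s.Iso t → s.Sub t := by
  rintro ⟨e, h₁, h₂, h₃⟩
  exact ⟨e.hom, inferInstance, h₁, h₂, POCM.Le.of_eq Q h₃⟩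

lemma Sub.trans {s t r : QSpan Q A B} : s.Sub t → t.Sub r → s.Sub r := by
  rintro ⟨m, _, h₁, h₂, h₃⟩ ⟨m', _, h₁', h₂', h₃'⟩
  refine ⟨m ≫ m', mono_comp _ _, by simp [h₁, h₁'], by simp [h₂, h₂'], ?_⟩
  rw [Category.assoc]
  exact h₃.trans (h₃'.comp m)

lemma tensor_iso {s s' : QSpan Q A B} {t t' : QSpan Q A' B'} :
    s.Iso s' → t.Iso t' → (s.tensor t).Iso (s'.tensor t') := by
  rintro ⟨e, h₁, h₂, h₃⟩ ⟨e', h₁', h₂', h₃'⟩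
  refine Iso.mk' (e ⊗ᵢ e') ?_ ?_ ?_
  · simp [h₁, h₁']
  · simp [h₂, h₂']
  · simp [h₃, h₃']

lemma tensor_sub {s s' : QSpan Q A B} {t t' : QSpan Q A' B'} :
    s.Sub s' → t.Sub t' → (s.tensor t).Sub (s'.tensor t') := by
  rintro ⟨m, _, h₁, h₂, h₃⟩ ⟨m', _, h₁', h₂', h₃'⟩
  refine Sub.mk' (m ⊗ₘ m') ⟨fun a b hab => ?_⟩ ?_ ?_ ?_
  · apply CartesianMonoidalCategory.hom_ext
    · rw [← cancel_mono m]
      simpa using congrArg (· ≫ fst _ _) hab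
    · rw [← cancel_mono m']
      simpa using congrArg (· ≫ snd _ _) hab
  · simp [h₁, h₁']
  · simp [h₂, h₂']
  · rw [tensor_mul, tensor_mul, MonObj.comp_mul]
    refine ((h₃.comp _).mul (h₃'.comp _)).trans (POCM.Le.of_eq Q ?_)
    simp

lemma tensor_graph (f : A ⟶ B) (g : A' ⟶ B') :
    ((graph Q f).tensor (graph Q g)).Iso (graph Q (f ⊗ₘ g)) := by
  refine Iso.mk' (CategoryTheory.Iso.refl _) ?_ ?_ ?_
  · simp [graph]
  · simp [graph]
  · dsimp only [graph]
    rw [tensor_mul]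
    simp only [unit_char, MonObj.comp_one, mul_one]

section Limits

variable [HasFiniteLimits E]

attribute [local simp] pullback.lift_fst pullback.lift_snd pullback.lift_fst_assoc
  pullback.lift_snd_assoc

lemma comp_iso {s s' : QSpan Q A B} {t t' : QSpan Q B C} :
    s.Iso s' → t.Iso t' → (s.comp t).Iso (s'.comp t') := by
  rintro ⟨e, h₁, h₂, h₃⟩ ⟨e', h₁', h₂', h₃'⟩
  refine Iso.mk' (asIso (pullback.map s.right t.left s'.right t'.left e.hom e'.hom (𝟙 _)
    (by simp [h₂]) (by simp [h₁']))) ?_ ?_ ?_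
  · simp [h₁]
  · simp [h₂']
  · rw [lift_mul, lift_mul, MonObj.comp_mul]
    simp [h₃, h₃']

lemma comp_sub {s s' : QSpan Q A B} {t t' : QSpan Q B C} :
    s.Sub s' → t.Sub t' → (s.comp t).Sub (s'.comp t') := by
  rintro ⟨m, _, h₁, h₂, h₃⟩ ⟨m', _, h₁', h₂', h₃'⟩
  refine Sub.mk' (pullback.map s.right t.left s'.right t'.left m m' (𝟙 _)
    (by simp [h₂]) (by simp [h₁'])) ⟨fun a b hab => ?_⟩ ?_ ?_ ?_
  · apply pullback.hom_ext
    · rw [← cancel_mono m]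
      simpa using congrArg (· ≫ pullback.fst _ _) hab
    · rw [← cancel_mono m']
      simpa using congrArg (· ≫ pullback.snd _ _) hab
  · simp [h₁]
  · simp [h₂']
  · rw [lift_mul, lift_mul, MonObj.comp_mul]
    refine ((h₃.comp _).mul (h₃'.comp _)).trans (POCM.Le.of_eq Q ?_)
    simp

lemma comp_assoc (s : QSpan Q A B) (t : QSpan Q B C) (r : QSpan Q C D) :
    ((s.comp t).comp r).Iso (s.comp (t.comp r)) := by
  refine Iso.mk' (pullbackAssoc s.right t.left t.right r.left) ?_ ?_ ?_
  · simp [comp]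
  · simp [comp]
  · dsimp only [comp]
    simp only [lift_mul, MonObj.comp_mul, mul_assoc]
    simp

/-- Composition with the graph of a morphism changes the right leg. -/
lemma comp_graph (s : QSpan Q A B) (f : B ⟶ C) :
    (s.comp (graph Q f)).Iso ⟨s.apex, s.left, s.right ≫ f, s.char⟩ := by
  have hc := pullback.condition (f := s.right) (g := 𝟙 B)
  refine Iso.mk' (X := pullback s.right (𝟙 B)) ⟨pullback.fst _ _,
    pullback.lift (𝟙 _) s.right (by simp), ?_, by simp⟩ ?_ ?_ ?_
  · apply pullback.hom_ext
    · simp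
    · simpa using hc
  · simp [graph]
  · simp only [Category.comp_id] at hc
    simp [graph, reassoc_of% hc]
  · dsimp only [graph]
    simp only [lift_mul, unit_char, MonObj.comp_one, mul_one]

/-- Composition with the graph of an isomorphism changes the left leg. -/
lemma graph_comp (e : A ≅ B) (s : QSpan Q B C) :
    ((graph Q e.hom).comp s).Iso ⟨s.apex, s.left ≫ e.inv, s.right, s.char⟩ := by
  have hc := pullback.condition (f := e.hom) (g := s.left)
  have hc' : pullback.fst e.hom s.left = pullback.snd _ _ ≫ s.left ≫ e.inv := by
    rw [← Category.assoc, ← hc]; simp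
  refine Iso.mk' (X := pullback e.hom s.left) ⟨pullback.snd _ _,
    pullback.lift (s.left ≫ e.inv) (𝟙 _) (by simp), ?_, by simp⟩ ?_ ?_ ?_
  · apply pullback.hom_ext
    · simpa using hc'.symm
    · simp
  · simpa [graph] using hc'
  · simp [graph]
  · dsimp only [graph]
    simp only [lift_mul, unit_char, MonObj.comp_one, one_mul]

lemma comp_id (s : QSpan Q A B) : (s.comp (id Q B)).Iso s := by
  have h := comp_graph s (𝟙 B)
  rwa [Category.comp_id] at h

lemma id_comp (s : QSpan Q A B) : ((id Q A).comp s).Iso s := by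
  have h := graph_comp (CategoryTheory.Iso.refl A) s
  rw [CategoryTheory.Iso.refl_inv, Category.comp_id] at h
  exact h

lemma graph_comp_graph (f : A ⟶ B) (g : B ⟶ C) :
    ((graph Q f).comp (graph Q g)).Iso (graph Q (f ≫ g)) := comp_graph _ _

lemma tensor_comp (s : QSpan Q A B) (t : QSpan Q B C) (s' : QSpan Q A' B') (t' : QSpan Q B' C') :
    ((s.tensor s').comp (t.tensor t')).Iso ((s.comp t).tensor (s'.comp t')) := by
  have hc := pullback.condition (f := s.right ⊗ₘ s'.right) (g := t.left ⊗ₘ t'.left)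
  refine Iso.mk' (X := pullback (s.right ⊗ₘ s'.right) (t.left ⊗ₘ t'.left))
    (Y := pullback s.right t.left ⊗ pullback s'.right t'.left) ⟨lift
    (pullback.lift (pullback.fst _ _ ≫ fst _ _) (pullback.snd _ _ ≫ fst _ _)
      (by simpa using congrArg (· ≫ fst _ _) hc))
    (pullback.lift (pullback.fst _ _ ≫ snd _ _) (pullback.snd _ _ ≫ snd _ _)
      (by simpa using congrArg (· ≫ snd _ _) hc)),
    pullback.lift (pullback.fst _ _ ⊗ₘ pullback.fst _ _) (pullback.snd _ _ ⊗ₘ pullback.snd _ _)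
      (by simp only [tensorHom_comp_tensorHom, pullback.condition]), ?_, ?_⟩ ?_ ?_ ?_
  · apply pullback.hom_ext
    · apply CartesianMonoidalCategory.hom_ext
      · simp
      · simp
    · apply CartesianMonoidalCategory.hom_ext
      · simp
      · simp
  · apply CartesianMonoidalCategory.hom_ext
    · apply pullback.hom_ext
      · simp
      · simp
    · apply pullback.hom_ext
      · simp
      · simp
  · apply CartesianMonoidalCategory.hom_ext
    · simp [comp, tensor]
    · simp [comp, tensor]
  · apply CartesianMonoidalCategory.hom_ext
    · simp [comp, tensor]
    · simp [comp, tensor]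
  · dsimp only [comp, tensor]
    simp only [tensor_mul, MonObj.comp_mul]
    rw [mul_mul_mul_comm]
    simp

end Limits

end QSpan

end Spans

/-! ### Preorder-enriched monoidal categories and their functors -/

section Preord

universe v₁ v₂ u₁ u₂

/-- A preordered category: hom-sets are preordered and composition is monotone. -/
class PreordCategory (C : Type u₁) [Category.{v₁} C] where
  homPreorder (X Y : C) : Preorder (X ⟶ Y)
  comp_mono {X Y Z : C} {f f' : X ⟶ Y} {g g' : Y ⟶ Z} :
    f ≤ f' → g ≤ g' → f ≫ g ≤ f' ≫ g'

instance {C : Type u₁} [Category.{v₁} C] [PreordCategory C] (X Y : C) : Preorder (X ⟶ Y) :=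
  PreordCategory.homPreorder X Y

/-- A preordered monoidal category: moreover the tensor product of morphisms is monotone. -/
class PreordMonoidalCategory (C : Type u₁) [Category.{v₁} C] [MonoidalCategory C] extends
    PreordCategory C where
  tensor_mono {X Y X' Y' : C} {f f' : X ⟶ Y} {g g' : X' ⟶ Y'} :
    f ≤ f' → g ≤ g' → (f ⊗ₘ g) ≤ (f' ⊗ₘ g')

/-- A `Preord`-functor is a functor which is monotone on hom-sets. -/
def IsPreordFunctor {C : Type u₁} [Category.{v₁} C] [PreordCategory C] {D : Type u₂}
    [Category.{v₂} D] [PreordCategory D] (F : C ⥤ D) : Prop :=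
  ∀ ⦃X Y : C⦄ ⦃f g : X ⟶ Y⦄, f ≤ g → F.map f ≤ F.map g

/-- A strict symmetric monoidal functor: a symmetric monoidal functor which preserves the unit and
tensor products on the nose, and whose structure morphisms are identities. -/
def IsStrictSymmetricMonoidal {C : Type u₁} [Category.{v₁} C] [MonoidalCategory C]
    [SymmetricCategory C] {D : Type u₂} [Category.{v₂} D] [MonoidalCategory D]
    [SymmetricCategory D] (F : C ⥤ D) : Prop :=
  ∃ (_ : F.Braided) (hε : 𝟙_ D = F.obj (𝟙_ C))
    (hμ : ∀ X Y : C, F.obj X ⊗ F.obj Y = F.obj (X ⊗ Y)),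
    Functor.LaxMonoidal.ε F = eqToHom hε ∧
      ∀ X Y : C, Functor.LaxMonoidal.μ F X Y = eqToHom (hμ X Y)

end Preord

/-! ### The category of algebras and algebraic `Q`-spans -/

section AlgebraicSpans

variable {E : Type u} [Category.{v} E] [CartesianMonoidalCategory E] [BraidedCategory E]
  [HasFiniteLimits E]

/-- A `Q`-span between algebras is algebraic if, in the internal language, for all operations `σ`
and all `xᵢ, aᵢ, bᵢ` with `f(xᵢ) = aᵢ` and `g(xᵢ) = bᵢ`, there exists `y` such that
`f(y) = σ(a₁, ..., aₙ)`, `g(y) = σ(b₁, ..., bₙ)` and `χ(x₁) ⊗ ... ⊗ χ(xₙ) ≤ χ(y)`. This is spelled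
out by the Kripke-Joyal semantics: the `xᵢ, aᵢ, bᵢ` are generalized elements at an arbitrary
stage `T`, and the existential quantifier provides a witness `y` on a cover `T' ↠ T`. -/
def QSpan.IsAlgebraic {Q : POCM E} {S : Signature.{w}} (A B : SigAlgebra E S)
    (s : QSpan Q A.carrier B.carrier) : Prop :=
  ∀ (σ : S.Op) (T : E) (x : Fin (S.arity σ) → (T ⟶ s.apex))
    (a : Fin (S.arity σ) → (T ⟶ A.carrier)) (b : Fin (S.arity σ) → (T ⟶ B.carrier)),
    (∀ i, x i ≫ s.left = a i ∧ x i ≫ s.right = b i) →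
      ∃ (T' : E) (e : T' ⟶ T) (y : T' ⟶ s.apex), Epi e ∧
        y ≫ s.left = e ≫ A.apply σ a ∧ y ≫ s.right = e ≫ B.apply σ b ∧
          Q.Le (e ≫ ∏ i, x i ≫ s.char) (y ≫ s.char)

namespace QSpan

variable {Q : POCM E} {S : Signature.{w}} {A B C A' B' : SigAlgebra E S}

lemma IsAlgebraic.of_iso {s t : QSpan Q A.carrier B.carrier} (hs : IsAlgebraic A B s)
    (h : s.Iso t) : IsAlgebraic A B t := by
  obtain ⟨e, h₁, h₂, h₃⟩ := h
  intro σ T x a b hx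
  obtain ⟨T', c, y, hc, hy₁, hy₂, hy₃⟩ := hs σ T (fun i => x i ≫ e.inv) a b
    (fun i => by simpa [h₁, h₂] using hx i)
  refine ⟨T', c, y ≫ e.hom, hc, by simpa [h₁] using hy₁, by simpa [h₂] using hy₂, ?_⟩
  simpa [h₃] using hy₃

lemma isAlgebraic_graph {f : A.carrier ⟶ B.carrier} (hf : SigAlgebra.IsHom A B f) :
    IsAlgebraic A B (graph Q f) := by
  intro σ T x a b hx
  refine ⟨T, 𝟙 T, A.apply σ a, inferInstance, ?_, ?_, ?_⟩
  · exact (Category.comp_id _).trans (Category.id_comp _).symm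
  · refine (hf.apply_comp σ a).trans (Eq.trans ?_ (Category.id_comp _).symm)
    congr 1
    funext i
    rw [← (hx i).1, ← (hx i).2]
    exact congrArg (· ≫ f) (Category.comp_id (x i))
  · refine POCM.Le.of_eq Q ?_
    dsimp only [graph]
    simp only [unit_char, MonObj.comp_one, Finset.prod_const_one]

lemma IsAlgebraic.comp {s : QSpan Q A.carrier B.carrier} {t : QSpan Q B.carrier C.carrier}
    (hs : IsAlgebraic A B s) (ht : IsAlgebraic B C t) : IsAlgebraic A C (s.comp t) := by
  intro σ T z a c hz
  have hz₁ : ∀ i, (z i ≫ pullback.fst s.right t.left) ≫ s.left = a i := fun i =>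
    (Category.assoc _ _ _).trans (hz i).1
  have hz₂ : ∀ i, (z i ≫ pullback.snd s.right t.left) ≫ t.right = c i := fun i =>
    (Category.assoc _ _ _).trans (hz i).2
  have hz₃ : ∀ i, (z i ≫ pullback.snd s.right t.left) ≫ t.left =
      (z i ≫ pullback.fst s.right t.left) ≫ s.right := fun i => by
    rw [Category.assoc, Category.assoc, pullback.condition]
  obtain ⟨T₁, e₁, x, he₁, hx₁, hx₂, hx₃⟩ := hs σ T (fun i => z i ≫ pullback.fst s.right t.left)
    a _ (fun i => ⟨hz₁ i, rfl⟩)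
  obtain ⟨T₂, e₂, y, he₂, hy₁, hy₂, hy₃⟩ := ht σ T₁
    (fun i => e₁ ≫ z i ≫ pullback.snd s.right t.left) _ _ (fun i => ⟨rfl, rfl⟩)
  have h : (e₂ ≫ x) ≫ s.right = y ≫ t.left := by
    rw [hy₁, Category.assoc, hx₂, SigAlgebra.comp_apply]
    congr 2
    funext i
    rw [Category.assoc e₁, hz₃ i]
  refine ⟨T₂, e₂ ≫ e₁, pullback.lift (e₂ ≫ x) y h, epi_comp _ _, ?_, ?_, ?_⟩
  · exact (pullback.lift_fst_assoc _ _ _ _).trans (by rw [Category.assoc, hx₁, Category.assoc])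
  · refine (pullback.lift_snd_assoc _ _ _ _).trans ?_
    rw [hy₂, Category.assoc, SigAlgebra.comp_apply (f := e₁)]
    congr 2
    funext i
    rw [← hz₂ i, Category.assoc]
  · have h₁ := (hx₃.comp e₂).mul hy₃
    refine (POCM.Le.of_eq Q ?_).trans (h₁.trans (POCM.Le.of_eq Q ?_))
    · have : ∀ i, z i ≫ (s.comp t).char = (z i ≫ pullback.fst s.right t.left ≫ s.char) *
          (z i ≫ pullback.snd s.right t.left ≫ t.char) := fun i => by
        rw [← MonObj.comp_mul, ← lift_mul]
      simp only [this, Finset.prod_mul_distrib, MonObj.comp_mul, POCM.comp_prod, Category.assoc]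
    · refine Eq.symm ((congrArg (pullback.lift (e₂ ≫ x) y h ≫ ·) (lift_mul
        (pullback.fst s.right t.left) (pullback.snd s.right t.left) s.char t.char)).trans ?_)
      rw [MonObj.comp_mul, pullback.lift_fst_assoc, pullback.lift_snd_assoc, Category.assoc]

lemma IsAlgebraic.tensor {s : QSpan Q A.carrier B.carrier} {t : QSpan Q A'.carrier B'.carrier}
    (hs : IsAlgebraic A B s) (ht : IsAlgebraic A' B' t) :
    IsAlgebraic (A.prod A') (B.prod B') (s.tensor t) := by
  intro σ T z a b hz
  obtain ⟨T₁, e₁, x, he₁, hx₁, hx₂, hx₃⟩ := hs σ T (fun i => z i ≫ fst s.apex t.apex)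
    (fun i => a i ≫ fst _ _) (fun i => b i ≫ fst _ _) (fun i => by
      rw [← (hz i).1, ← (hz i).2]
      simp [QSpan.tensor])
  obtain ⟨T₂, e₂, y, he₂, hy₁, hy₂, hy₃⟩ := ht σ T₁ (fun i => e₁ ≫ z i ≫ snd s.apex t.apex)
    (fun i => e₁ ≫ a i ≫ snd _ _) (fun i => e₁ ≫ b i ≫ snd _ _) (fun i => by
      rw [← (hz i).1, ← (hz i).2]
      simp [QSpan.tensor])
  refine ⟨T₂, e₂ ≫ e₁, lift (e₂ ≫ x) y, epi_comp _ _, ?_, ?_, ?_⟩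
  · refine CartesianMonoidalCategory.hom_ext _ _ ?_ ?_
    · rw [Category.assoc (e₂ ≫ e₁)]
      erw [SigAlgebra.apply_fst]
      simp [QSpan.tensor, hx₁]
    · rw [Category.assoc (e₂ ≫ e₁)]
      erw [SigAlgebra.apply_snd]
      simp [QSpan.tensor, hy₁, SigAlgebra.comp_apply]
  · refine CartesianMonoidalCategory.hom_ext _ _ ?_ ?_
    · rw [Category.assoc (e₂ ≫ e₁)]
      erw [SigAlgebra.apply_fst]
      simp [QSpan.tensor, hx₂]
    · rw [Category.assoc (e₂ ≫ e₁)]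
      erw [SigAlgebra.apply_snd]
      simp [QSpan.tensor, hy₂, SigAlgebra.comp_apply]
  · have h₁ := (hx₃.comp e₂).mul hy₃
    refine (POCM.Le.of_eq Q ?_).trans (h₁.trans (POCM.Le.of_eq Q ?_))
    · have : ∀ i, z i ≫ (s.tensor t).char = (z i ≫ fst s.apex t.apex ≫ s.char) *
          (z i ≫ snd s.apex t.apex ≫ t.char) := fun i => by
        rw [← MonObj.comp_mul, ← tensor_mul]
      simp only [this, Finset.prod_mul_distrib, MonObj.comp_mul, POCM.comp_prod, Category.assoc]
    · refine Eq.symm ((congrArg (lift (e₂ ≫ x) y ≫ ·) (tensor_mul s.char t.char)).trans ?_)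
      rw [MonObj.comp_mul, lift_fst_assoc, lift_snd_assoc, Category.assoc]

end QSpan

/-- The category whose objects are `(Σ, E)`-algebras and whose morphisms are isomorphism classes of
algebraic `Q`-spans. -/
structure SpanCat (V : Variety.{w}) (Q : POCM E) where
  alg : V.Algebra E

namespace SpanCat

variable {V : Variety.{w}} {Q : POCM E}

/-- Isomorphism of `Q`-spans as an equivalence relation on algebraic `Q`-spans. -/
def spanSetoid (A B : SpanCat V Q) :
    Setoid {s : QSpan Q A.alg.carrier B.alg.carrier //
      s.IsAlgebraic A.alg.toSigAlgebra B.alg.toSigAlgebra} where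
  r s t := s.1.Iso t.1
  iseqv := ⟨fun _ => QSpan.Iso.refl _, fun h => h.symm, fun h h' => h.trans h'⟩

/-- The isomorphism class of an algebraic `Q`-span. -/
def classOf {A B : SpanCat V Q} (s : QSpan Q A.alg.carrier B.alg.carrier)
    (hs : s.IsAlgebraic A.alg.toSigAlgebra B.alg.toSigAlgebra) : Quotient (spanSetoid A B) :=
  Quotient.mk _ ⟨s, hs⟩

lemma classOf_eq {A B : SpanCat V Q} {s t : QSpan Q A.alg.carrier B.alg.carrier}
    {hs : s.IsAlgebraic A.alg.toSigAlgebra B.alg.toSigAlgebra}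
    {ht : t.IsAlgebraic A.alg.toSigAlgebra B.alg.toSigAlgebra} (h : s.Iso t) :
    classOf s hs = classOf t ht := Quotient.sound h

noncomputable instance : Category (SpanCat V Q) where
  Hom A B := Quotient (spanSetoid A B)
  id A := classOf (QSpan.id Q A.alg.carrier)
    (QSpan.isAlgebraic_graph (SigAlgebra.IsHom.id A.alg.toSigAlgebra))
  comp := Quotient.map₂ (fun s t => ⟨s.1.comp t.1, s.2.comp t.2⟩)
    (fun _ _ h _ _ h' => QSpan.comp_iso h h')
  id_comp := by
    rintro A B ⟨s, hs⟩
    exact classOf_eq (QSpan.id_comp s)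
  comp_id := by
    rintro A B ⟨s, hs⟩
    exact classOf_eq (QSpan.comp_id s)
  assoc := by
    rintro A B C D ⟨s, hs⟩ ⟨t, ht⟩ ⟨r, hr⟩
    exact classOf_eq (QSpan.comp_assoc s t r)

/-- The morphism represented by an algebraic `Q`-span. -/
def homMk {A B : SpanCat V Q} (s : QSpan Q A.alg.carrier B.alg.carrier)
    (hs : s.IsAlgebraic A.alg.toSigAlgebra B.alg.toSigAlgebra) : A ⟶ B :=
  classOf s hs

lemma homMk_eq {A B : SpanCat V Q} {s t : QSpan Q A.alg.carrier B.alg.carrier}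
    {hs : s.IsAlgebraic A.alg.toSigAlgebra B.alg.toSigAlgebra}
    {ht : t.IsAlgebraic A.alg.toSigAlgebra B.alg.toSigAlgebra} (h : s.Iso t) :
    homMk s hs = homMk t ht := Quotient.sound h

lemma hom_ind {A B : SpanCat V Q} {P : (A ⟶ B) → Prop} (h : ∀ s hs, P (homMk s hs))
    (f : A ⟶ B) : P f := Quotient.ind (fun s => h s.1 s.2) f

lemma homMk_comp {A B C : SpanCat V Q} {s : QSpan Q A.alg.carrier B.alg.carrier}
    {t : QSpan Q B.alg.carrier C.alg.carrier}
    (hs : s.IsAlgebraic A.alg.toSigAlgebra B.alg.toSigAlgebra)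
    (ht : t.IsAlgebraic B.alg.toSigAlgebra C.alg.toSigAlgebra) :
    homMk s hs ≫ homMk t ht = homMk (s.comp t) (hs.comp ht) := rfl

/-- The graph of an algebra homomorphism. -/
def graph {A B : SpanCat V Q} (f : A.alg.carrier ⟶ B.alg.carrier)
    (hf : SigAlgebra.IsHom A.alg.toSigAlgebra B.alg.toSigAlgebra f) : A ⟶ B :=
  homMk (QSpan.graph Q f) (QSpan.isAlgebraic_graph hf)

lemma graph_comp_graph {A B C : SpanCat V Q} {f : A.alg.carrier ⟶ B.alg.carrier}
    {g : B.alg.carrier ⟶ C.alg.carrier}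
    (hf : SigAlgebra.IsHom A.alg.toSigAlgebra B.alg.toSigAlgebra f)
    (hg : SigAlgebra.IsHom B.alg.toSigAlgebra C.alg.toSigAlgebra g) :
    graph (Q := Q) (A := A) (B := B) f hf ≫ graph g hg = graph (f ≫ g) (hf.comp hg) :=
  homMk_eq (QSpan.graph_comp_graph f g)

lemma graph_congr {A B : SpanCat V Q} {f g : A.alg.carrier ⟶ B.alg.carrier}
    {hf : SigAlgebra.IsHom A.alg.toSigAlgebra B.alg.toSigAlgebra f}
    {hg : SigAlgebra.IsHom A.alg.toSigAlgebra B.alg.toSigAlgebra g} (h : f = g) :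
    graph (Q := Q) (A := A) (B := B) f hf = graph g hg := by
  subst h; rfl

lemma graph_id (A : SpanCat V Q) :
    graph (Q := Q) (A := A) (B := A) (𝟙 _) (SigAlgebra.IsHom.id _) = 𝟙 A := rfl

/-- The graph of an isomorphism of algebras. -/
def graphIso {A B : SpanCat V Q} (e : A.alg.carrier ≅ B.alg.carrier)
    (he : SigAlgebra.IsHom A.alg.toSigAlgebra B.alg.toSigAlgebra e.hom) : A ≅ B where
  hom := graph e.hom he
  inv := graph e.inv he.inv
  hom_inv_id := by
    rw [graph_comp_graph, ← graph_id]
    exact graph_congr e.hom_inv_id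
  inv_hom_id := by
    rw [graph_comp_graph, ← graph_id]
    exact graph_congr e.inv_hom_id

/-- The tensor product of morphisms: the tensor product of representing `Q`-spans. -/
noncomputable def tensorHom {A B A' B' : SpanCat V Q} :
    (A ⟶ B) → (A' ⟶ B') →
      ((⟨A.alg.prod A'.alg⟩ : SpanCat V Q) ⟶ (⟨B.alg.prod B'.alg⟩ : SpanCat V Q)) :=
  Quotient.map₂ (fun s t => ⟨s.1.tensor t.1, s.2.tensor t.2⟩)
    (fun _ _ h _ _ h' => QSpan.tensor_iso h h')

/-- The tensor product of objects is the product of algebras, the unit is the terminal algebra, and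
the coherence isomorphisms are the graphs of those of the finite products of `E`. -/
noncomputable instance : MonoidalCategoryStruct (SpanCat V Q) where
  tensorObj A B := ⟨A.alg.prod B.alg⟩
  tensorUnit := ⟨Variety.Algebra.terminal E V⟩
  tensorHom f g := tensorHom f g
  whiskerLeft A _ _ f := tensorHom (𝟙 A) f
  whiskerRight f B := tensorHom f (𝟙 B)
  associator A B C := graphIso (A := ⟨(A.alg.prod B.alg).prod C.alg⟩)
    (B := ⟨A.alg.prod (B.alg.prod C.alg)⟩)
    (α_ A.alg.carrier B.alg.carrier C.alg.carrier) (SigAlgebra.isHom_associator _ _ _)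
  leftUnitor A := graphIso (A := ⟨(Variety.Algebra.terminal E V).prod A.alg⟩) (B := A)
    (λ_ A.alg.carrier) (by rw [leftUnitor_hom]; exact SigAlgebra.isHom_snd _ _)
  rightUnitor A := graphIso (A := ⟨A.alg.prod (Variety.Algebra.terminal E V)⟩) (B := A)
    (ρ_ A.alg.carrier) (by rw [rightUnitor_hom]; exact SigAlgebra.isHom_fst _ _)

lemma homMk_tensor {A B A' B' : SpanCat V Q} {s : QSpan Q A.alg.carrier B.alg.carrier}
    {t : QSpan Q A'.alg.carrier B'.alg.carrier}
    (hs : s.IsAlgebraic A.alg.toSigAlgebra B.alg.toSigAlgebra)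
    (ht : t.IsAlgebraic A'.alg.toSigAlgebra B'.alg.toSigAlgebra) :
    homMk s hs ⊗ₘ homMk t ht =
      homMk (A := A ⊗ A') (B := B ⊗ B') (s.tensor t) (hs.tensor ht) := rfl

lemma isHom_tensor {A B A' B' : SpanCat V Q} {f : A.alg.carrier ⟶ B.alg.carrier}
    {g : A'.alg.carrier ⟶ B'.alg.carrier}
    (hf : SigAlgebra.IsHom A.alg.toSigAlgebra B.alg.toSigAlgebra f)
    (hg : SigAlgebra.IsHom A'.alg.toSigAlgebra B'.alg.toSigAlgebra g) :
    SigAlgebra.IsHom (A ⊗ A').alg.toSigAlgebra (B ⊗ B').alg.toSigAlgebra (f ⊗ₘ g) := by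
  refine SigAlgebra.isHom_prod ?_ ?_
  · rw [tensorHom_fst]
    exact (SigAlgebra.isHom_fst _ _).comp hf
  · rw [tensorHom_snd]
    exact (SigAlgebra.isHom_snd _ _).comp hg

lemma graph_tensor {A B A' B' : SpanCat V Q} {f : A.alg.carrier ⟶ B.alg.carrier}
    {g : A'.alg.carrier ⟶ B'.alg.carrier}
    (hf : SigAlgebra.IsHom A.alg.toSigAlgebra B.alg.toSigAlgebra f)
    (hg : SigAlgebra.IsHom A'.alg.toSigAlgebra B'.alg.toSigAlgebra g) :
    (graph f hf ⊗ₘ graph g hg : A ⊗ A' ⟶ B ⊗ B') =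
      graph (A := A ⊗ A') (B := B ⊗ B') (f ⊗ₘ g) (isHom_tensor hf hg) :=
  homMk_eq (QSpan.tensor_graph f g)

/-- The morphism `φ` is the graph of the homomorphism `f`. -/
def IsGraph {A B : SpanCat V Q} (φ : A ⟶ B) (f : A.alg.carrier ⟶ B.alg.carrier) : Prop :=
  ∃ hf : SigAlgebra.IsHom A.alg.toSigAlgebra B.alg.toSigAlgebra f, φ = graph f hf

namespace IsGraph

lemma id (A : SpanCat V Q) : IsGraph (𝟙 A) (𝟙 A.alg.carrier) := ⟨SigAlgebra.IsHom.id _, rfl⟩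

lemma comp {A B C : SpanCat V Q} {φ : A ⟶ B} {ψ : B ⟶ C} {f : A.alg.carrier ⟶ B.alg.carrier}
    {g : B.alg.carrier ⟶ C.alg.carrier} : IsGraph φ f → IsGraph ψ g → IsGraph (φ ≫ ψ) (f ≫ g) := by
  rintro ⟨hf, rfl⟩ ⟨hg, rfl⟩
  exact ⟨hf.comp hg, graph_comp_graph hf hg⟩

lemma tensor {A B A' B' : SpanCat V Q} {φ : A ⟶ B} {ψ : A' ⟶ B'}
    {f : A.alg.carrier ⟶ B.alg.carrier} {g : A'.alg.carrier ⟶ B'.alg.carrier} :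
    IsGraph φ f → IsGraph ψ g → IsGraph (φ ⊗ₘ ψ) (f ⊗ₘ g) := by
  rintro ⟨hf, rfl⟩ ⟨hg, rfl⟩
  exact ⟨isHom_tensor hf hg, graph_tensor hf hg⟩

lemma eq {A B : SpanCat V Q} {φ ψ : A ⟶ B} {f g : A.alg.carrier ⟶ B.alg.carrier} :
    IsGraph φ f → IsGraph ψ g → f = g → φ = ψ := by
  rintro ⟨hf, rfl⟩ ⟨hg, rfl⟩ rfl
  rfl

lemma hom {A B : SpanCat V Q} (e : A.alg.carrier ≅ B.alg.carrier)
    (he : SigAlgebra.IsHom A.alg.toSigAlgebra B.alg.toSigAlgebra e.hom) :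
    IsGraph (graphIso e he).hom e.hom := ⟨he, rfl⟩

lemma inv {A B : SpanCat V Q} (e : A.alg.carrier ≅ B.alg.carrier)
    (he : SigAlgebra.IsHom A.alg.toSigAlgebra B.alg.toSigAlgebra e.hom) :
    IsGraph (graphIso e he).inv e.inv := ⟨he.inv, rfl⟩

lemma associator (A B C : SpanCat V Q) :
    IsGraph (α_ A B C).hom (α_ A.alg.carrier B.alg.carrier C.alg.carrier).hom :=
  ⟨SigAlgebra.isHom_associator _ _ _, rfl⟩

lemma associator_inv (A B C : SpanCat V Q) :
    IsGraph (α_ A B C).inv (α_ A.alg.carrier B.alg.carrier C.alg.carrier).inv :=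
  ⟨(SigAlgebra.isHom_associator _ _ _).inv, rfl⟩

lemma leftUnitor (A : SpanCat V Q) : IsGraph (λ_ A).hom (λ_ A.alg.carrier).hom :=
  ⟨by rw [leftUnitor_hom]; exact SigAlgebra.isHom_snd _ _, rfl⟩

lemma rightUnitor (A : SpanCat V Q) : IsGraph (ρ_ A).hom (ρ_ A.alg.carrier).hom :=
  ⟨by rw [rightUnitor_hom]; exact SigAlgebra.isHom_fst _ _, rfl⟩

/-- Naturality of graphs of isomorphisms follows from an isomorphism of representing spans. -/
lemma naturality {A A' B B' : SpanCat V Q} (s : QSpan Q A.alg.carrier B.alg.carrier)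
    (t : QSpan Q A'.alg.carrier B'.alg.carrier)
    {hs : s.IsAlgebraic A.alg.toSigAlgebra B.alg.toSigAlgebra}
    {ht : t.IsAlgebraic A'.alg.toSigAlgebra B'.alg.toSigAlgebra}
    {φ : A ⟶ A'} {ψ : B ⟶ B'}
    {e : A.alg.carrier ≅ A'.alg.carrier} {e' : B.alg.carrier ≅ B'.alg.carrier}
    (hφ : IsGraph φ e.hom) (hψ : IsGraph ψ e'.hom)
    (i : s.apex ≅ t.apex) (h₁ : s.left ≫ e.hom = i.hom ≫ t.left)
    (h₂ : s.right ≫ e'.hom = i.hom ≫ t.right) (h₃ : s.char = i.hom ≫ t.char) :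
    homMk s hs ≫ ψ = φ ≫ homMk t ht := by
  obtain ⟨he, rfl⟩ := hφ
  obtain ⟨he', rfl⟩ := hψ
  refine homMk_eq ((QSpan.comp_graph s e'.hom).trans (QSpan.Iso.trans ?_
    (QSpan.graph_comp e t).symm))
  refine QSpan.Iso.mk' i ?_ h₂ h₃
  rw [← Category.assoc, ← h₁]
  simp

end IsGraph

noncomputable instance : MonoidalCategory (SpanCat V Q) :=
  MonoidalCategory.ofTensorHom
    (id_tensorHom_id := fun A B =>
      ((IsGraph.id A).tensor (IsGraph.id B)).eq (IsGraph.id (A ⊗ B)) (id_tensorHom_id _ _))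
    (id_tensorHom := fun _ _ _ _ => rfl)
    (tensorHom_id := fun _ _ => rfl)
    (tensorHom_comp_tensorHom := fun f₁ f₂ g₁ g₂ => by
      induction f₁ using hom_ind with | _ s₁ hs₁
      induction f₂ using hom_ind with | _ s₂ hs₂
      induction g₁ using hom_ind with | _ t₁ ht₁
      induction g₂ using hom_ind with | _ t₂ ht₂
      exact homMk_eq (QSpan.tensor_comp s₁ t₁ s₂ t₂))
    (associator_naturality := fun {A₁ A₂ A₃ B₁ B₂ B₃} f₁ f₂ f₃ => by
      induction f₁ using hom_ind with | _ s₁ hs₁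
      induction f₂ using hom_ind with | _ s₂ hs₂
      induction f₃ using hom_ind with | _ s₃ hs₃
      refine IsGraph.naturality (A := (A₁ ⊗ A₂) ⊗ A₃) (B := (B₁ ⊗ B₂) ⊗ B₃)
        (A' := A₁ ⊗ A₂ ⊗ A₃) (B' := B₁ ⊗ B₂ ⊗ B₃)
        ((s₁.tensor s₂).tensor s₃) (s₁.tensor (s₂.tensor s₃))
        (IsGraph.associator _ _ _) (IsGraph.associator _ _ _)
        (α_ s₁.apex s₂.apex s₃.apex) ?_ ?_ ?_
      · exact associator_naturality s₁.left s₂.left s₃.left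
      · exact associator_naturality s₁.right s₂.right s₃.right
      · simp only [QSpan.tensor_mul, MonObj.comp_mul, mul_assoc]
        simp)
    (leftUnitor_naturality := fun {A B} f => by
      induction f using hom_ind with | _ s hs
      refine IsGraph.naturality (A := 𝟙_ _ ⊗ A) (B := 𝟙_ _ ⊗ B) (A' := A) (B' := B)
        ((QSpan.id Q (𝟙_ E)).tensor s) s
        (IsGraph.leftUnitor _) (IsGraph.leftUnitor _) (λ_ s.apex) ?_ ?_ ?_
      · exact (congrArg (· ≫ (λ_ _).hom) (id_tensorHom _ _)).trans (leftUnitor_naturality s.left)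
      · exact (congrArg (· ≫ (λ_ _).hom) (id_tensorHom _ _)).trans (leftUnitor_naturality s.right)
      · simp only [QSpan.tensor_mul, QSpan.unit_char, MonObj.comp_one, one_mul]
        simp [leftUnitor_hom])
    (rightUnitor_naturality := fun {A B} f => by
      induction f using hom_ind with | _ s hs
      refine IsGraph.naturality (A := A ⊗ 𝟙_ _) (B := B ⊗ 𝟙_ _) (A' := A) (B' := B)
        (s.tensor (QSpan.id Q (𝟙_ E))) s
        (IsGraph.rightUnitor _) (IsGraph.rightUnitor _) (ρ_ s.apex) ?_ ?_ ?_
      · exact (congrArg (· ≫ (ρ_ _).hom) (tensorHom_id _ _)).trans (rightUnitor_naturality s.left)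
      · exact (congrArg (· ≫ (ρ_ _).hom) (tensorHom_id _ _)).trans (rightUnitor_naturality s.right)
      · simp only [QSpan.tensor_mul, QSpan.unit_char, MonObj.comp_one, mul_one]
        simp [rightUnitor_hom])
    (pentagon := fun A B C D =>
      (((IsGraph.associator A B C).tensor (IsGraph.id D)).comp
        ((IsGraph.associator A (B ⊗ C) D).comp
          ((IsGraph.id A).tensor (IsGraph.associator B C D)))).eq
        ((IsGraph.associator (A ⊗ B) C D).comp (IsGraph.associator A B (C ⊗ D))) (by
          have h := MonoidalCategory.pentagon A.alg.carrier B.alg.carrier C.alg.carrier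
            D.alg.carrier
          rw [← tensorHom_id, ← id_tensorHom] at h
          exact h))
    (triangle := fun A B =>
      ((IsGraph.associator A (𝟙_ _) B).comp
        ((IsGraph.id A).tensor (IsGraph.leftUnitor B))).eq
        ((IsGraph.rightUnitor A).tensor (IsGraph.id B)) (by
          have h := MonoidalCategory.triangle A.alg.carrier B.alg.carrier
          rw [← tensorHom_id, ← id_tensorHom] at h
          exact h))

/-- The isomorphism of algebras `A × B ≅ B × A`, as an isomorphism of `SpanCat V Q`. -/
noncomputable def braid (A B : SpanCat V Q) : A ⊗ B ≅ B ⊗ A :=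
  graphIso (A := A ⊗ B) (B := B ⊗ A) (β_ A.alg.carrier B.alg.carrier)
    (SigAlgebra.isHom_braiding _ _)

lemma IsGraph.braid (A B : SpanCat V Q) :
    IsGraph (SpanCat.braid A B).hom (β_ A.alg.carrier B.alg.carrier).hom :=
  ⟨SigAlgebra.isHom_braiding _ _, rfl⟩

/-- The symmetry is the graph of the symmetry of the finite products of `E`. -/
noncomputable instance : BraidedCategory (SpanCat V Q) where
  braiding A B := braid A B
  braiding_naturality_right A B C f := by
    induction f using hom_ind with | _ s hs
    refine IsGraph.naturality (A := A ⊗ B) (B := A ⊗ C) (A' := B ⊗ A) (B' := C ⊗ A)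
      ((QSpan.id Q A.alg.carrier).tensor s) (s.tensor (QSpan.id Q A.alg.carrier))
      (IsGraph.braid _ _) (IsGraph.braid _ _) (β_ A.alg.carrier s.apex) ?_ ?_ ?_
    · exact BraidedCategory.braiding_naturality (𝟙 A.alg.carrier) s.left
    · exact BraidedCategory.braiding_naturality (𝟙 A.alg.carrier) s.right
    · simp only [QSpan.tensor_mul, QSpan.unit_char, MonObj.comp_one, mul_one, one_mul]
      simp
  braiding_naturality_left {A B} f C := by
    induction f using hom_ind with | _ s hs
    refine IsGraph.naturality (A := A ⊗ C) (B := B ⊗ C) (A' := C ⊗ A) (B' := C ⊗ B)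
      (s.tensor (QSpan.id Q C.alg.carrier)) ((QSpan.id Q C.alg.carrier).tensor s)
      (IsGraph.braid _ _) (IsGraph.braid _ _) (β_ s.apex C.alg.carrier) ?_ ?_ ?_
    · exact BraidedCategory.braiding_naturality s.left (𝟙 C.alg.carrier)
    · exact BraidedCategory.braiding_naturality s.right (𝟙 C.alg.carrier)
    · simp only [QSpan.tensor_mul, QSpan.unit_char, MonObj.comp_one, mul_one, one_mul]
      simp
  hexagon_forward A B C := by
    rw [← tensorHom_id, ← id_tensorHom]
    exact ((IsGraph.associator A B C).comp ((IsGraph.braid A (B ⊗ C)).comp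
      (IsGraph.associator B C A))).eq
        (((IsGraph.braid A B).tensor (IsGraph.id C)).comp ((IsGraph.associator B A C).comp
          ((IsGraph.id B).tensor (IsGraph.braid A C)))) (by
      have h := BraidedCategory.hexagon_forward A.alg.carrier B.alg.carrier C.alg.carrier
      rw [← tensorHom_id, ← id_tensorHom] at h
      exact h)
  hexagon_reverse A B C := by
    rw [← tensorHom_id, ← id_tensorHom]
    exact ((IsGraph.associator_inv A B C).comp ((IsGraph.braid (A ⊗ B) C).comp
      (IsGraph.associator_inv C A B))).eq
        (((IsGraph.id A).tensor (IsGraph.braid B C)).comp ((IsGraph.associator_inv A C B).comp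
          ((IsGraph.braid A C).tensor (IsGraph.id B)))) (by
      have h := BraidedCategory.hexagon_reverse A.alg.carrier B.alg.carrier C.alg.carrier
      rw [← tensorHom_id, ← id_tensorHom] at h
      exact h)

noncomputable instance : SymmetricCategory (SpanCat V Q) where
  symmetry A B := ((IsGraph.braid A B).comp (IsGraph.braid B A)).eq (IsGraph.id (A ⊗ B))
    (SymmetricCategory.symmetry A.alg.carrier B.alg.carrier)

/-- The order on morphisms induced by the order on representing `Q`-spans. -/
def homLE {A B : SpanCat V Q} : (A ⟶ B) → (A ⟶ B) → Prop :=
  Quotient.lift₂ (fun s t => s.1.Sub t.1) (fun _ _ _ _ h h' => propext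
    ⟨fun hs => (h.symm.sub.trans hs).trans h'.sub, fun hs => (h.sub.trans hs).trans h'.symm.sub⟩)

instance : PreordMonoidalCategory (SpanCat V Q) where
  homPreorder A B :=
    { le := homLE
      le_refl := by
        rintro ⟨s, hs⟩
        exact (QSpan.Iso.refl s).sub
      le_trans := by
        rintro ⟨s, hs⟩ ⟨t, ht⟩ ⟨r, hr⟩ h h'
        exact QSpan.Sub.trans h h' }
  comp_mono := by
    rintro A B C ⟨s, hs⟩ ⟨s', hs'⟩ ⟨t, ht⟩ ⟨t', ht'⟩ h h'
    exact QSpan.comp_sub h h'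
  tensor_mono := by
    rintro A B A' B' ⟨s, hs⟩ ⟨s', hs'⟩ ⟨t, ht⟩ ⟨t', ht'⟩ h h'
    exact QSpan.tensor_sub h h'

end SpanCat

end AlgebraicSpans

end AlgSpan

/-!
Postcomposition with `h` changes only the characteristic morphism of a `Q`-span, so the pullbacks
and products of apices formed in `SpanCat V Q₁` and in `SpanCat V Q₂` are literally the same. On
characteristic morphisms, all constructions are monoid operations on generalized elements of `Q₁`,
and these are preserved by `h`. Hence representing spans are carried to representing spans by
equalities, not merely isomorphisms, and every structure morphism of the functor is an identity.
Algebraicity survives because its inequality is between products of generalized elements, and `h`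
is a monotone homomorphism.
-/

namespace AlgSpan

section StrictMonoidal

variable {C D : Type*} [Category* C] [MonoidalCategory C] [Category* D] [MonoidalCategory D]

/-- The monoidal structure, with identities `eqToHom` as structure morphisms, of a functor which
preserves unit, tensor product and coherence isomorphisms on the nose. Since the two sides of these
equations only have propositionally equal endpoints, they are stated as heterogeneous equalities. -/
def strictCoreMonoidal (F : C ⥤ D) (unit_eq : 𝟙_ D = F.obj (𝟙_ C))
    (tensor_eq : ∀ X Y : C, F.obj X ⊗ F.obj Y = F.obj (X ⊗ Y))
    (map_tensorHom : ∀ {X Y X' Y' : C} (f : X ⟶ Y) (g : X' ⟶ Y'),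
      F.map (f ⊗ₘ g) ≍ F.map f ⊗ₘ F.map g)
    (map_associator : ∀ X Y Z : C,
      F.map (α_ X Y Z).hom ≍ (α_ (F.obj X) (F.obj Y) (F.obj Z)).hom)
    (map_leftUnitor : ∀ X : C, F.map (λ_ X).hom ≍ (λ_ (F.obj X)).hom)
    (map_rightUnitor : ∀ X : C, F.map (ρ_ X).hom ≍ (ρ_ (F.obj X)).hom) : F.CoreMonoidal where
  εIso := eqToIso unit_eq
  μIso X Y := eqToIso (tensor_eq X Y)
  μIso_hom_natural_left f X := by
    have h := map_tensorHom f (𝟙 X)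
    rw [F.map_id, tensorHom_id, tensorHom_id] at h
    simpa only [eqToIso.hom, ← heq_eq_eq, comp_eqToHom_heq_iff, heq_eqToHom_comp_iff] using h.symm
  μIso_hom_natural_right X f := by
    have h := map_tensorHom (𝟙 X) f
    rw [F.map_id, id_tensorHom, id_tensorHom] at h
    simpa only [eqToIso.hom, ← heq_eq_eq, comp_eqToHom_heq_iff, heq_eqToHom_comp_iff] using h.symm
  associativity X Y Z := by
    simpa only [eqToIso.hom, eqToHom_whiskerRight, whiskerLeft_eqToHom, eqToHom_trans,
      ← heq_eq_eq, eqToHom_comp_heq_iff, heq_comp_eqToHom_iff] using map_associator X Y Z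
  left_unitality X := by
    simpa only [eqToIso.hom, eqToHom_whiskerRight, ← heq_eq_eq, heq_eqToHom_comp_iff]
      using (map_leftUnitor X).symm
  right_unitality X := by
    simpa only [eqToIso.hom, whiskerLeft_eqToHom, ← heq_eq_eq, heq_eqToHom_comp_iff]
      using (map_rightUnitor X).symm

lemma isStrictSymmetricMonoidal_of_map_heq [SymmetricCategory C] [SymmetricCategory D] {F : C ⥤ D}
    (unit_eq : 𝟙_ D = F.obj (𝟙_ C)) (tensor_eq : ∀ X Y : C, F.obj X ⊗ F.obj Y = F.obj (X ⊗ Y))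
    (map_tensorHom : ∀ {X Y X' Y' : C} (f : X ⟶ Y) (g : X' ⟶ Y'),
      F.map (f ⊗ₘ g) ≍ F.map f ⊗ₘ F.map g)
    (map_associator : ∀ X Y Z : C,
      F.map (α_ X Y Z).hom ≍ (α_ (F.obj X) (F.obj Y) (F.obj Z)).hom)
    (map_leftUnitor : ∀ X : C, F.map (λ_ X).hom ≍ (λ_ (F.obj X)).hom)
    (map_rightUnitor : ∀ X : C, F.map (ρ_ X).hom ≍ (ρ_ (F.obj X)).hom)
    (map_braiding : ∀ X Y : C, F.map (β_ X Y).hom ≍ (β_ (F.obj X) (F.obj Y)).hom) :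
    IsStrictSymmetricMonoidal F := by
  let core : F.CoreMonoidal := strictCoreMonoidal F unit_eq tensor_eq map_tensorHom map_associator
    map_leftUnitor map_rightUnitor
  have braided (X Y : C) : eqToHom (tensor_eq X Y) ≫ F.map (β_ X Y).hom =
      (β_ (F.obj X) (F.obj Y)).hom ≫ eqToHom (tensor_eq Y X) := by
    simpa only [← heq_eq_eq, eqToHom_comp_heq_iff, heq_comp_eqToHom_iff] using map_braiding X Y
  exact ⟨{ core.toMonoidal with braided := braided }, unit_eq, tensor_eq, rfl, fun _ _ => rfl⟩

end StrictMonoidal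

section Postcomposition

variable {E : Type u} [Category.{v} E] [CartesianMonoidalCategory E] [BraidedCategory E]

lemma prod_comp_of_isMonHom {M N : E} [MonObj M] [IsCommMonObj M] [MonObj N] [IsCommMonObj N]
    (f : M ⟶ N) [IsMonHom f] {T : E} {J : Type*} (s : Finset J) (x : J → (T ⟶ M)) :
    (∏ j ∈ s, x j) ≫ f = ∏ j ∈ s, x j ≫ f :=
  map_prod (IsMonHom.monoidHom f T) x s

variable {Q₁ Q₂ Q₃ : POCM E}

instance POCM.isMonHom_hom (h : Q₁ ⟶ Q₂) : IsMonHom h.hom := h.isMonHom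

namespace QSpan

section

variable {A B C A' B' : E}

lemma Iso.postcomp {s t : QSpan Q₁ A B} (hst : s.Iso t) (h : Q₁ ⟶ Q₂) :
    (s.postcomp h).Iso (t.postcomp h) := by
  obtain ⟨e, left_eq, right_eq, char_eq⟩ := hst
  exact ⟨e, left_eq, right_eq, by simp only [char_eq, Category.assoc]⟩

lemma Sub.postcomp {s t : QSpan Q₁ A B} (hst : s.Sub t) (h : Q₁ ⟶ Q₂) :
    (s.postcomp h).Sub (t.postcomp h) := by
  obtain ⟨m, hm, left_eq, right_eq, char_le⟩ := hst
  refine ⟨m, hm, left_eq, right_eq, ?_⟩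
  simpa only [Category.assoc] using h.monotone _ _ char_le

lemma graph_postcomp (f : A ⟶ B) (h : Q₁ ⟶ Q₂) : (graph Q₁ f).postcomp h = graph Q₂ f :=
  congrArg (QSpan.mk A (𝟙 A) f) (MonObj.one_comp h.hom)

lemma comp_postcomp [HasFiniteLimits E] (s : QSpan Q₁ A B) (t : QSpan Q₁ B C) (h : Q₁ ⟶ Q₂) :
    (s.comp t).postcomp h = (s.postcomp h).comp (t.postcomp h) := by
  have char_eq : (s.comp t).char ≫ h.hom = ((s.postcomp h).comp (t.postcomp h)).char := by
    simp only [lift_mul, MonObj.mul_comp, Category.assoc]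
  exact congrArg (QSpan.mk _ _ _) char_eq

lemma tensor_postcomp (s : QSpan Q₁ A B) (t : QSpan Q₁ A' B') (h : Q₁ ⟶ Q₂) :
    (s.tensor t).postcomp h = (s.postcomp h).tensor (t.postcomp h) := by
  have char_eq : (s.tensor t).char ≫ h.hom = ((s.postcomp h).tensor (t.postcomp h)).char := by
    simp only [tensor_mul, MonObj.mul_comp, Category.assoc]
  exact congrArg (QSpan.mk _ _ _) char_eq

lemma postcomp_id (s : QSpan Q₁ A B) : s.postcomp (𝟙 Q₁) = s :=
  congrArg (QSpan.mk s.apex s.left s.right) (Category.comp_id s.char)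

lemma postcomp_comp (s : QSpan Q₁ A B) (h : Q₁ ⟶ Q₂) (g : Q₂ ⟶ Q₃) :
    s.postcomp (h ≫ g) = (s.postcomp h).postcomp g :=
  congrArg (QSpan.mk s.apex s.left s.right) (Category.assoc s.char h.hom g.hom).symm

end

lemma IsAlgebraic.postcomp {S : Signature.{w}} {A B : SigAlgebra E S}
    {s : QSpan Q₁ A.carrier B.carrier} (hs : IsAlgebraic A B s) (h : Q₁ ⟶ Q₂) :
    IsAlgebraic A B (s.postcomp h) := by
  intro σ T x a b hx
  obtain ⟨T', e, y, he, left_eq, right_eq, char_le⟩ := hs σ T x a b hx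
  refine ⟨T', e, y, he, left_eq, right_eq, ?_⟩
  simpa only [Category.assoc, prod_comp_of_isMonHom] using h.monotone _ _ char_le

end QSpan

namespace SpanCat

variable [HasFiniteLimits E] {V : Variety.{w}}

lemma homMk_congr {A B : SpanCat V Q₁} {s t : QSpan Q₁ A.alg.carrier B.alg.carrier}
    {hs : s.IsAlgebraic A.alg.toSigAlgebra B.alg.toSigAlgebra}
    {ht : t.IsAlgebraic A.alg.toSigAlgebra B.alg.toSigAlgebra} (h : s = t) :
    homMk s hs = homMk t ht :=
  homMk_eq (h ▸ QSpan.Iso.refl s)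

/-- The functor `h^*` of the paper: the identity on algebras, postcomposition of the characteristic
morphisms with `h` on algebraic spans. -/
def postcompFunctor (V : Variety.{w}) (h : Q₁ ⟶ Q₂) :
    SpanCat V Q₁ ⥤ SpanCat V Q₂ where
  obj A := ⟨A.alg⟩
  map {A B} := Quotient.map (sa := spanSetoid A B) (sb := spanSetoid ⟨A.alg⟩ ⟨B.alg⟩)
    (fun s => ⟨s.1.postcomp h, s.2.postcomp h⟩) (fun _ _ hst => QSpan.Iso.postcomp hst h)
  map_id A := homMk_congr (A := ⟨A.alg⟩) (B := ⟨A.alg⟩) (QSpan.graph_postcomp (𝟙 _) h)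
  map_comp {A B C} φ ψ := by
    induction φ using hom_ind with | _ s hs
    induction ψ using hom_ind with | _ t ht
    exact homMk_congr (A := ⟨A.alg⟩) (B := ⟨C.alg⟩) (QSpan.comp_postcomp s t h)

lemma postcompFunctor_map_homMk (h : Q₁ ⟶ Q₂) {A B : SpanCat V Q₁}
    {s : QSpan Q₁ A.alg.carrier B.alg.carrier}
    (hs : s.IsAlgebraic A.alg.toSigAlgebra B.alg.toSigAlgebra) :
    (postcompFunctor V h).map (homMk s hs) =
      homMk (Q := Q₂) (A := ⟨A.alg⟩) (B := ⟨B.alg⟩) (s.postcomp h) (hs.postcomp h) :=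
  rfl

lemma IsGraph.map_postcompFunctor (h : Q₁ ⟶ Q₂) {A B : SpanCat V Q₁} {φ : A ⟶ B}
    {f : A.alg.carrier ⟶ B.alg.carrier} (hφ : IsGraph φ f) :
    IsGraph (Q := Q₂) (A := ⟨A.alg⟩) (B := ⟨B.alg⟩) ((postcompFunctor V h).map φ) f := by
  obtain ⟨hf, rfl⟩ := hφ
  exact ⟨hf, homMk_congr (A := ⟨A.alg⟩) (B := ⟨B.alg⟩) (QSpan.graph_postcomp f h)⟩

lemma postcompFunctor_map_tensorHom (h : Q₁ ⟶ Q₂) {A B A' B' : SpanCat V Q₁} (φ : A ⟶ B)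
    (ψ : A' ⟶ B') : (postcompFunctor V h).map (φ ⊗ₘ ψ) =
      ((postcompFunctor V h).map φ ⊗ₘ (postcompFunctor V h).map ψ :) := by
  induction φ using hom_ind with | _ s hs
  induction ψ using hom_ind with | _ t ht
  exact homMk_congr (A := ⟨(A ⊗ A').alg⟩) (B := ⟨(B ⊗ B').alg⟩) (QSpan.tensor_postcomp s t h)

lemma isStrictSymmetricMonoidal_postcompFunctor (h : Q₁ ⟶ Q₂) :
    IsStrictSymmetricMonoidal (postcompFunctor V h) :=
  isStrictSymmetricMonoidal_of_map_heq rfl (fun _ _ => rfl)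
    (fun φ ψ => heq_of_eq (postcompFunctor_map_tensorHom h φ ψ))
    (fun A B C => heq_of_eq (((IsGraph.associator A B C).map_postcompFunctor h).eq
      (IsGraph.associator (Q := Q₂) ⟨A.alg⟩ ⟨B.alg⟩ ⟨C.alg⟩) rfl))
    (fun A => heq_of_eq (((IsGraph.leftUnitor A).map_postcompFunctor h).eq
      (IsGraph.leftUnitor (Q := Q₂) ⟨A.alg⟩) rfl))
    (fun A => heq_of_eq (((IsGraph.rightUnitor A).map_postcompFunctor h).eq
      (IsGraph.rightUnitor (Q := Q₂) ⟨A.alg⟩) rfl))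
    (fun A B => heq_of_eq (((IsGraph.braid A B).map_postcompFunctor h).eq
      (IsGraph.braid (Q := Q₂) ⟨A.alg⟩ ⟨B.alg⟩) rfl))

lemma isPreordFunctor_postcompFunctor (h : Q₁ ⟶ Q₂) :
    IsPreordFunctor (postcompFunctor V h) := by
  rintro A B ⟨s, hs⟩ ⟨t, ht⟩ hst
  exact QSpan.Sub.postcomp hst h

lemma postcompFunctor_id (Q : POCM E) : postcompFunctor V (𝟙 Q) = 𝟭 (SpanCat V Q) := by
  refine Functor.hext (fun _ => rfl) fun A B φ => heq_of_eq ?_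
  induction φ using hom_ind with | _ s hs
  exact homMk_congr (A := A) (B := B) (QSpan.postcomp_id s)

lemma postcompFunctor_comp (h : Q₁ ⟶ Q₂) (g : Q₂ ⟶ Q₃) :
    postcompFunctor V (h ≫ g) = postcompFunctor V h ⋙ postcompFunctor V g := by
  refine Functor.hext (fun _ => rfl) fun A B φ => heq_of_eq ?_
  induction φ using hom_ind with | _ s hs
  exact homMk_congr (A := ⟨A.alg⟩) (B := ⟨B.alg⟩) (QSpan.postcomp_comp s h g)

end SpanCat

end Postcomposition

end AlgSpan

theorem mainTheorem6_general {E : Type u} [CategoryTheory.Category.{v} E]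
    [CartesianMonoidalCategory E] [BraidedCategory E] [HasFiniteLimits E]
    (V : AlgSpan.Variety.{w}) :
    ∃ star : ∀ {Q₁ Q₂ : AlgSpan.POCM.{v, u} E}, (Q₁ ⟶ Q₂) →
        (AlgSpan.SpanCat V Q₁ ⥤ AlgSpan.SpanCat V Q₂),
      (∀ {Q₁ Q₂ : AlgSpan.POCM.{v, u} E} (h : Q₁ ⟶ Q₂),
        (∃ obj_eq : ∀ A : AlgSpan.SpanCat V Q₁, (star h).obj A = ⟨A.alg⟩,
          ∀ (A B : AlgSpan.SpanCat V Q₁)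
            (s : AlgSpan.QSpan Q₁ A.alg.carrier B.alg.carrier)
            (hs : s.IsAlgebraic A.alg.toSigAlgebra B.alg.toSigAlgebra),
            ∃ hs' : (s.postcomp h).IsAlgebraic A.alg.toSigAlgebra B.alg.toSigAlgebra,
              (star h).map (AlgSpan.SpanCat.homMk s hs) =
                eqToHom (obj_eq A) ≫
                  (AlgSpan.SpanCat.homMk (s.postcomp h) hs' :
                    (⟨A.alg⟩ : AlgSpan.SpanCat V Q₂) ⟶ ⟨B.alg⟩) ≫
                  eqToHom (obj_eq B).symm) ∧
        AlgSpan.IsStrictSymmetricMonoidal (star h) ∧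
        AlgSpan.IsPreordFunctor (star h)) ∧
      (∀ Q : AlgSpan.POCM.{v, u} E, star (𝟙 Q) = 𝟭 (AlgSpan.SpanCat V Q)) ∧
      (∀ {Q₁ Q₂ Q₃ : AlgSpan.POCM.{v, u} E} (h : Q₁ ⟶ Q₂) (g : Q₂ ⟶ Q₃),
        star (h ≫ g) = star h ⋙ star g) := by
  refine ⟨AlgSpan.SpanCat.postcompFunctor V, fun h => ⟨⟨fun _ => rfl, fun A B s hs => ?_⟩,
    AlgSpan.SpanCat.isStrictSymmetricMonoidal_postcompFunctor h,
    AlgSpan.SpanCat.isPreordFunctor_postcompFunctor h⟩,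
    AlgSpan.SpanCat.postcompFunctor_id, AlgSpan.SpanCat.postcompFunctor_comp⟩
  exact ⟨hs.postcomp h, (conj_eqToHom_iff_heq' _ _ _ _).2
    (heq_of_eq (AlgSpan.SpanCat.postcompFunctor_map_homMk h hs))⟩

theorem mainTheorem6 {E : Type u} [CategoryTheory.Category.{v} E]
    [CartesianMonoidalCategory E] [BraidedCategory E] [HasFiniteLimits E] [MonoidalClosed E]
    [HasSubobjectClassifier E] (V : AlgSpan.Variety.{w}) :
    ∃ star : ∀ {Q₁ Q₂ : AlgSpan.POCM.{v, u} E}, (Q₁ ⟶ Q₂) →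
        (AlgSpan.SpanCat V Q₁ ⥤ AlgSpan.SpanCat V Q₂),
      (∀ {Q₁ Q₂ : AlgSpan.POCM.{v, u} E} (h : Q₁ ⟶ Q₂),
        (∃ obj_eq : ∀ A : AlgSpan.SpanCat V Q₁, (star h).obj A = ⟨A.alg⟩,
          ∀ (A B : AlgSpan.SpanCat V Q₁)
            (s : AlgSpan.QSpan Q₁ A.alg.carrier B.alg.carrier)
            (hs : s.IsAlgebraic A.alg.toSigAlgebra B.alg.toSigAlgebra),
            ∃ hs' : (s.postcomp h).IsAlgebraic A.alg.toSigAlgebra B.alg.toSigAlgebra,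
              (star h).map (AlgSpan.SpanCat.homMk s hs) =
                eqToHom (obj_eq A) ≫
                  (AlgSpan.SpanCat.homMk (s.postcomp h) hs' :
                    (⟨A.alg⟩ : AlgSpan.SpanCat V Q₂) ⟶ ⟨B.alg⟩) ≫
                  eqToHom (obj_eq B).symm) ∧
        AlgSpan.IsStrictSymmetricMonoidal (star h) ∧
        AlgSpan.IsPreordFunctor (star h)) ∧
      (∀ Q : AlgSpan.POCM.{v, u} E, star (𝟙 Q) = 𝟭 (AlgSpan.SpanCat V Q)) ∧
      (∀ {Q₁ Q₂ Q₃ : AlgSpan.POCM.{v, u} E} (h : Q₁ ⟶ Q₂) (g : Q₂ ⟶ Q₃),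
        star (h ≫ g) = star h ⋙ star g) :=
  mainTheorem6_general V
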